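/- Let $d\ge 1$ be an integer, let $R_0(w)\in\mathbb C[w]$ be a polynomial of degree $d$ with only simple zeros, and let $P(z,w)\in\mathbb C[z,w]$ be a polynomial of total degree at most $d$. For $\delta\in\mathbb C$ put $R_\delta(z,w)=R_0(w)+\delta P(z,w)$, let $\Gamma_\delta$ be the closure in $\hat{\mathbb C}\times\hat{\mathbb C}$ of $\{(z,w)\in\mathbb C^2: R_\delta(z,w)=0\}$, and let $F_\delta$ be the holomorphic correspondence on $\hat{\mathbb C}$ defined by $R_\delta$, that is, the multivalued map $F_\delta(z)=\{w\in\hat{\mathbb C}:(z,w)\in\Gamma_\delta\}$, where the points of $F_\delta(z)$ are counted with the multiplicity of the intersection of $\Gamma_\delta$ with $\{z\}\times\hat{\mathbb C}$ (if $R_\delta$ does not depend on $z$, then $F_\delta(z)$ consists of the zeros of $R_\delta$ for every $z\in\hat{\mathbb C}$). For a finite Borel measure $\mu$ on $\hat{\mathbb C}$ the push-forward $(F_\delta)_*\mu$ is the measure with $\langle (F_\delta)_*\mu,\phi\rangle=\int\sum_{x\in F_\delta(a)}\phi(x)\,d\mu(a)$ for continuous $\phi$, with multiplicities taken into account; in particular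 $(F_\delta)_*\delta_a=\sum_{x\in F_\delta(a)}\delta_x$, where $\delta_a$ is the Dirac measure at $a$. $F_\delta^m$ denotes the $m$-th iterate, with multiplicities. A set $S\subset\hat{\mathbb C}$ is forward invariant under $F_\delta$ if $F_\delta(S)\subset S$. For every $\epsilon>0$ there is $\Delta>0$ (depending on $R_0$, $P$ and $\epsilon$) such that for every $\delta\in\mathbb C$ with $|\delta|<\Delta$ there is a regular Borel probability measure $\mu_{F_\delta}$ on $\hat{\mathbb C}$ with the following properties. 1. $(F_\delta)_*\mu_{F_\delta}=d\,\mu_{F_\delta}$. 2. For every $a\in\mathbb C$, $\frac1{d^m}(F_\delta^m)_*\delta_a\to\mu_{F_\delta}$ in the weak* sense as $m\to\infty$. 3. $\operatorname{supp}\mu_{F_\delta}$ is contained in $\mathbb C$ and in the $\epsilon$-neighbourhood of the set of zeros of $R_0$. 4. $\operatorname{supp}\mu_{F_\delta}$ is the minimal set that is closed in $\hat{\mathbb C}$, forward invariant under $F_\delta$ and contains a point of $\mathbb C$: it has these three properties and is contained in every set that has them. -/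

import Mathlib

open scoped Polynomial OnePoint ENNReal

/-- The Borel σ-algebra of the Riemann sphere `ℂ ∪ {∞}`. -/
noncomputable instance instMeasurableSpaceRiemannSphere : MeasurableSpace (OnePoint ℂ) := borel (OnePoint ℂ)

instance instBorelSpaceRiemannSphere : BorelSpace (OnePoint ℂ) := ⟨rfl⟩

noncomputable section

namespace HolCorr

/-- The Riemann sphere. -/
abbrev Sphere : Type := OnePoint ℂ

/-! Polynomials in the two variables `z` and `w` are elements of `MvPolynomial (Fin 2) ℂ`;
variable `0` is `z` and variable `1` is `w`. -/

/-- The family `R_δ(z, w) = R₀(w) + δ P(z, w)`. -/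
def perturbed (R₀ : ℂ[X]) (P : MvPolynomial (Fin 2) ℂ) (δ : ℂ) : MvPolynomial (Fin 2) ℂ :=
  Polynomial.aeval (MvPolynomial.X 1) R₀ + MvPolynomial.C δ * P

/-- The closure in `Ĉ × Ĉ` of the affine curve `{(z, w) ∈ ℂ² : R(z, w) = 0}`. -/
def curve (R : MvPolynomial (Fin 2) ℂ) : Set (Sphere × Sphere) :=
  closure {p | ∃ z w : ℂ, MvPolynomial.eval ![z, w] R = 0 ∧ p = ((z : Sphere), (w : Sphere))}

/-- The multivalued map `F : z → w` defined by `R(z, w) = 0`, as a set-valued map: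
`F(z)` is the set of all `w` such that `(z, w)` lies on the compactified curve. -/
def image (R : MvPolynomial (Fin 2) ℂ) (z : Sphere) : Set Sphere := {w | (z, w) ∈ curve R}

/-- A set `S` is forward invariant under the correspondence defined by `R` if `F(S) ⊆ S`. -/
def ForwardInvariant (R : MvPolynomial (Fin 2) ℂ) (S : Set Sphere) : Prop :=
  (⋃ z ∈ S, image R z) ⊆ S

/-- `R(z, w)` as a polynomial in `z` (the outer variable) whose coefficients are
polynomials in `w`. -/
def asPolyInZ (R : MvPolynomial (Fin 2) ℂ) : ℂ[X][X] :=
  MvPolynomial.aeval ![(Polynomial.X : ℂ[X][X]), Polynomial.C Polynomial.X] R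

/-- The polynomial in `w` that cuts out the points of the curve over a given `z`.
For `z ∈ ℂ` it is `R(z, ·)`. For `z = ∞` it is the coefficient of the highest power of `z`
in `R`, that is, the value at `t = 0` of `t ^ e * R(1 / t, w)`, where `e` is the degree
of `R` in `z`. -/
def slice (R : MvPolynomial (Fin 2) ℂ) (z : Sphere) : ℂ[X] :=
  z.elim (asPolyInZ R).leadingCoeff (fun z₀ => (asPolyInZ R).eval (Polynomial.C z₀))

/-- The points of `F(z)` counted with multiplicity (the intersection multiplicity of the
compactified curve with `{z} × Ĉ`), for a curve that does not contain `{z} × Ĉ`: the zeros of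
the slice in `ℂ`, and the point `∞` with multiplicity the drop of the degree of the slice
below the degree of `R` in `w`. If `R` does not depend on `z`, this is the multiset of the
zeros of `R`, for every `z`. -/
def fiber (R : MvPolynomial (Fin 2) ℂ) (z : Sphere) : Multiset Sphere :=
  (slice R z).roots.map (fun w => (w : Sphere)) +
    Multiset.replicate (R.degreeOf 1 - (slice R z).natDegree) (∞ : Sphere)

/-- The `m`-th iterate of a multivalued map, with multiplicities. -/
def iter (F : Sphere → Multiset Sphere) : ℕ → Sphere → Multiset Sphere
  | 0, z => {z}
  | m + 1, z => (iter F m z).bind F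

/-- The push-forward `F_* μ` of a measure under a multivalued map with multiplicities:
`F_* δ_a` is the sum of the Dirac measures at the points of `F(a)`, counted with multiplicity,
and `F_* μ = ∫ F_* δ_a dμ(a)`, so that
`⟨F_* μ, φ⟩ = ∫ ∑_{x ∈ F(a)} φ(x) dμ(a)`. -/
def pushforward (F : Sphere → Multiset Sphere) (μ : MeasureTheory.Measure Sphere) :
    MeasureTheory.Measure Sphere :=
  μ.bind fun a => ((F a).map MeasureTheory.Measure.dirac).sum

/-- Weak* convergence of a sequence of measures on the (compact) sphere: convergence of the
integrals of all continuous functions. -/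
def WeakStarTendsto (ν : ℕ → MeasureTheory.Measure Sphere) (μ : MeasureTheory.Measure Sphere) :
    Prop :=
  ∀ φ : C(Sphere, ℂ),
    Filter.Tendsto (fun m => ∫ x, φ x ∂(ν m)) Filter.atTop (nhds (∫ x, φ x ∂μ))

end HolCorr

end

/-! For small δ the correspondence is a contracting iterated function system in disguise. Since `P`
has total degree at most d, comparing `R₀(w)` with `δ P(z, w)` shows that every root w over a finite
z satisfies |w| ≤ max(r, |z|)/2 (`exists_norm_root_le`). Hence a disc of radius r is mapped into
itself, every finite point has all its iterates in that disc after finitely many steps, and ∞ never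
lies over a finite point.

On the disc, `R_δ(z, ·)` has exactly one root near each simple zero of `R₀`. These roots are d
functions of z, and they are 1/2-Lipschitz because `R₀` expands distances near its zeros while z
enters only through `δ P` (`exists_contracting_branches`). Hutchinson's theorem
(`exists_invariant_measure`) gives an invariant measure that attracts all averages over the disc.
Its image on the sphere is μ, carried by the images of the branches, hence by points near the zeros
of `R₀`.

Minimality follows from equidistribution: if a closed forward invariant S contains a finite point a,
all iterates of a lie in S, so their limit μ has its support in S. -/

open Filter Topology MeasureTheory

namespace HolCorr


/-! ### Contracting iterated function systems and Hutchinson's theorem -/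

section IteratedFunctionSystem

variable {X E F ι : Type*} [Fintype ι] [NormedAddCommGroup E] [NormedSpace ℝ E]
  [NormedAddCommGroup F] [NormedSpace ℝ F]

/-- The transfer operator of an iterated function system with equal weights. -/
noncomputable def transfer (f : ι → X → X) (φ : X → E) (x : X) : E :=
  (Fintype.card ι : ℝ)⁻¹ • ∑ i, φ (f i x)

theorem transfer_add (f : ι → X → X) (φ ψ : X → E) :
    transfer f (φ + ψ) = transfer f φ + transfer f ψ := by
  ext x; simp [transfer, Finset.sum_add_distrib]

/-- Taking L to be a real scalar gives homogeneity of the limit functional; real and imaginary parts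
reduce complex test functions to real ones. -/
theorem map_transfer (f : ι → X → X) (L : E →L[ℝ] F) (φ : X → E) :
    L ∘ transfer f φ = transfer f (L ∘ φ) := by
  ext x; simp [transfer]

theorem map_transfer_iterate (f : ι → X → X) (L : E →L[ℝ] F) (φ : X → E) (m : ℕ) :
    L ∘ (transfer f)^[m] φ = (transfer f)^[m] (L ∘ φ) := by
  induction m with
  | zero => rfl
  | succ m ih => rw [Function.iterate_succ_apply', Function.iterate_succ_apply', map_transfer, ih]

theorem transfer_iterate_add (f : ι → X → X) (φ ψ : X → E) (m : ℕ) :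
    (transfer f)^[m] (φ + ψ) = (transfer f)^[m] φ + (transfer f)^[m] ψ := by
  induction m with
  | zero => rfl
  | succ m ih => simp only [Function.iterate_succ_apply', ih, transfer_add]

theorem dist_average_le [Nonempty ι] {a b : ι → E} {e : ℝ} (h : ∀ i, dist (a i) (b i) ≤ e) :
    dist ((Fintype.card ι : ℝ)⁻¹ • ∑ i, a i) ((Fintype.card ι : ℝ)⁻¹ • ∑ i, b i) ≤ e := by
  have hc : (0 : ℝ) < Fintype.card ι := by exact_mod_cast Fintype.card_pos
  rw [dist_smul₀, norm_inv, Real.norm_of_nonneg hc.le, inv_mul_le_iff₀ hc]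
  calc dist (∑ i, a i) (∑ i, b i) ≤ ∑ i, dist (a i) (b i) := dist_sum_sum_le _ _ _
    _ ≤ ∑ _i : ι, e := Finset.sum_le_sum fun i _ => h i
    _ = _ := by simp

theorem average_const [Nonempty ι] (c : E) :
    (Fintype.card ι : ℝ)⁻¹ • ∑ _i : ι, c = c := by
  have hc : (Fintype.card ι : ℝ) ≠ 0 := by exact_mod_cast Fintype.card_ne_zero
  rw [Finset.sum_const, Finset.card_univ, ← Nat.cast_smul_eq_nsmul ℝ, inv_smul_smul₀ hc]

/-- Balls are convex, so averaging cannot leave them. The case e = 0 says that constants are fixed.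
-/
theorem dist_transfer_iterate_const_le [Nonempty ι] (f : ι → X → X) {φ : X → E} {c : E} {e : ℝ}
    (h : ∀ y, dist (φ y) c ≤ e) (m : ℕ) (y : X) : dist ((transfer f)^[m] φ y) c ≤ e := by
  induction m generalizing y with
  | zero => exact h y
  | succ m ih =>
    rw [Function.iterate_succ_apply', transfer, ← average_const (ι := ι) c]
    exact dist_average_le fun i => ih _

/-- Words of length m in the maps shrink distances by K^m, so a modulus of continuity of φ at scale
s serves the m-th iterate at scale s / K^m. -/
theorem dist_transfer_iterate_le [PseudoMetricSpace X] [Nonempty ι] {f : ι → X → X}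
    {K : NNReal} (hf : ∀ i, LipschitzWith K (f i)) {φ : X → E} {s e : ℝ}
    (h : ∀ x y, dist x y ≤ s → dist (φ x) (φ y) ≤ e) (m : ℕ) (x y : X)
    (hxy : K ^ m * dist x y ≤ s) :
    dist ((transfer f)^[m] φ x) ((transfer f)^[m] φ y) ≤ e := by
  induction m generalizing x y with
  | zero => exact h x y (by simpa using hxy)
  | succ m ih =>
    rw [Function.iterate_succ_apply']
    refine dist_average_le fun i => ih _ _ (le_trans ?_ hxy)
    rw [pow_succ, mul_assoc]
    gcongr
    exact (hf i).dist_le_mul x y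

/-- The oscillation of the m-th iterate over X tends to 0. Later iterates are averages of its
values, so they form a Cauchy sequence at each point, with a limit independent of the point. -/
theorem exists_tendsto_transfer_iterate [PseudoMetricSpace X] [CompactSpace X] [Nonempty X]
    [Nonempty ι] [CompleteSpace E] {f : ι → X → X} {K : NNReal} (hK : K < 1)
    (hf : ∀ i, LipschitzWith K (f i)) {φ : X → E} (hφ : Continuous φ) :
    ∃ l, ∀ x, Tendsto (fun m => (transfer f)^[m] φ x) atTop (𝓝 l) := by
  have key : ∀ e > 0, ∃ N, ∀ m ≥ N, ∀ x y,
      dist ((transfer f)^[m] φ x) ((transfer f)^[m] φ y) ≤ e := by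
    intro e he
    obtain ⟨s, hs, h⟩ := Metric.uniformContinuous_iff.1
      (CompactSpace.uniformContinuous_of_continuous hφ) e he
    have ht : Tendsto (fun m : ℕ => (K : ℝ) ^ m * Metric.diam (Set.univ : Set X)) atTop (𝓝 0) := by
      simpa using (tendsto_pow_atTop_nhds_zero_of_lt_one K.2 (by exact_mod_cast hK)).mul_const
        (Metric.diam (Set.univ : Set X))
    obtain ⟨N, hN⟩ := eventually_atTop.1 (ht.eventually (ge_mem_nhds (half_pos hs)))
    -- Half of s turns the non-strict bound into the strict one of uniform continuity.
    refine ⟨N, fun m hm x y => dist_transfer_iterate_le hf (s := s / 2)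
      (fun x y hxy => (h (by linarith)).le) m x y (le_trans ?_ (hN m hm))⟩
    gcongr
    exact Metric.dist_le_diam_of_mem isCompact_univ.isBounded trivial trivial
  obtain ⟨x₀⟩ := ‹Nonempty X›
  have hc : CauchySeq fun m => (transfer f)^[m] φ x₀ := by
    refine Metric.cauchySeq_iff'.2 fun e he => ?_
    obtain ⟨N, hN⟩ := key (e / 2) (half_pos he)
    refine ⟨N, fun n hn => ?_⟩
    obtain ⟨k, rfl⟩ := Nat.exists_eq_add_of_le' hn
    rw [Function.iterate_add_apply]
    exact (dist_transfer_iterate_const_le f (fun y => hN N le_rfl y x₀) k x₀).trans_lt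
      (half_lt_self he)
  obtain ⟨l, hl⟩ := cauchySeq_tendsto_of_complete hc
  refine ⟨l, fun x => ?_⟩
  refine (tendsto_iff_of_dist ?_).1 hl
  refine Metric.tendsto_atTop.2 fun e he => ?_
  obtain ⟨N, hN⟩ := key (e / 2) (half_pos he)
  refine ⟨N, fun m hm => ?_⟩
  rw [Real.dist_0_eq_abs, abs_of_nonneg dist_nonneg]
  exact (hN m hm _ _).trans_lt (half_lt_self he)

theorem transfer_iterate_nonneg (f : ι → X → X) {φ : X → ℝ} (h : ∀ x, 0 ≤ φ x) (m : ℕ) (x : X) :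
    0 ≤ (transfer f)^[m] φ x := by
  induction m generalizing x with
  | zero => exact h x
  | succ m ih =>
    rw [Function.iterate_succ_apply']
    exact smul_nonneg (by positivity) (Finset.sum_nonneg fun i _ => ih _)

/-- **Hutchinson's theorem**: a contracting iterated function system on a compact metric space has
an invariant probability measure, to which the iterates of the transfer operator converge. -/
theorem exists_invariant_measure [MetricSpace X] [CompactSpace X] [Nonempty X] [MeasurableSpace X]
    [BorelSpace X] [Nonempty ι] {f : ι → X → X} {K : NNReal} (hK : K < 1)
    (hf : ∀ i, LipschitzWith K (f i)) :
    ∃ μ : Measure X, IsProbabilityMeasure μ ∧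
      ∑ i, μ.map (f i) = (Fintype.card ι : ℝ≥0∞) • μ ∧
      ∀ φ : X → ℂ, Continuous φ → ∀ x,
        Tendsto (fun m => (transfer f)^[m] φ x) atTop (𝓝 (∫ y, φ y ∂μ)) := by
  choose L hL using fun φ : CompactlySupportedContinuousMap X ℝ =>
    exists_tendsto_transfer_iterate hK hf φ.continuous
  have hcard : (Fintype.card ι : ℝ) ≠ 0 := by exact_mod_cast Fintype.card_ne_zero
  have x₀ : X := Classical.arbitrary X
  -- The limit is a positive linear functional of φ, so Riesz–Markov represents it by a measure.
  let Λ : PositiveLinearMap ℝ (CompactlySupportedContinuousMap X ℝ) ℝ := PositiveLinearMap.mk₀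
    { toFun := L
      map_add' := fun φ ψ => by
        refine tendsto_nhds_unique (hL (φ + ψ) x₀) ?_
        exact ((hL φ x₀).add (hL ψ x₀)).congr fun m =>
          (congrFun (transfer_iterate_add f φ ψ m) x₀).symm
      map_smul' := fun c φ => by
        refine tendsto_nhds_unique (hL (c • φ) x₀) ?_
        have h := (hL φ x₀).const_smul c
        refine h.congr fun m => ?_
        exact congrFun (map_transfer_iterate f (c • ContinuousLinearMap.id ℝ ℝ) φ m) x₀ }
    (fun φ hφ => ge_of_tendsto' (hL φ x₀) fun m => transfer_iterate_nonneg f (fun x => hφ x) m x₀)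
  have hΛ : ∀ φ, Λ φ = L φ := fun φ => rfl
  set μ := RealRMK.rieszMeasure Λ with hμ
  have hconv : ∀ φ : X → ℝ, Continuous φ → ∀ x,
      Tendsto (fun m => (transfer f)^[m] φ x) atTop (𝓝 (∫ y, φ y ∂μ)) := by
    intro φ hφ x
    have h := hL (CompactlySupportedContinuousMap.continuousMapEquiv ⟨φ, hφ⟩) x
    rw [← hΛ, ← RealRMK.integral_rieszMeasure] at h
    exact h
  have hprob : IsProbabilityMeasure μ := by
    have h := hconv (fun _ => 1) continuous_const x₀
    have h1 : ∀ m, (transfer f)^[m] (fun _ => (1 : ℝ)) x₀ = 1 := fun m =>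
      dist_le_zero.1 (dist_transfer_iterate_const_le f (fun y => by simp) m x₀)
    simp only [h1] at h
    have h2 := tendsto_nhds_unique h tendsto_const_nhds
    rw [integral_const, smul_eq_mul, mul_one] at h2
    exact ⟨by simpa [measureReal_def, ENNReal.toReal_eq_one_iff] using h2⟩
  have hint : ∀ φ : X → ℝ, Continuous φ → Integrable φ μ := fun φ hφ =>
    hφ.integrable_of_hasCompactSupport (HasCompactSupport.of_compactSpace φ)
  refine ⟨μ, hprob, ?_, ?_⟩
  · have : IsFiniteMeasure ((Fintype.card ι : ℝ≥0∞) • μ) :=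
      Measure.smul_finite μ (ENNReal.natCast_ne_top _)
    refine ext_of_forall_integral_eq_of_IsFiniteMeasure fun φ => ?_
    have hfm : ∀ i, Measurable (f i) := fun i => (hf i).continuous.measurable
    rw [integral_finsetSum_measure fun i _ => φ.integrable _, integral_smul_measure]
    simp_rw [integral_map (hfm _).aemeasurable φ.continuous.aestronglyMeasurable]
    have hcont : ∀ i, Continuous fun x => φ (f i x) := fun i => φ.continuous.comp (hf i).continuous
    have hT : Continuous (transfer f φ) := by
      unfold transfer
      exact Continuous.const_smul (continuous_finsetSum _ fun i _ => hcont i) (Fintype.card ι : ℝ)⁻¹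
    -- Iterating on `transfer f φ` only shifts the sequence for φ, so both have the same integral.
    have h := tendsto_nhds_unique (hconv _ hT x₀)
      ((hconv φ φ.continuous x₀).comp (tendsto_add_atTop_nat 1))
    unfold transfer at h
    rw [integral_smul, integral_finsetSum _ fun i _ => hint _ (hcont i)] at h
    rw [← h, ENNReal.toReal_natCast, smul_inv_smul₀ hcard]
  · intro φ hφ x
    have hi : Integrable φ μ := hφ.integrable_of_hasCompactSupport (HasCompactSupport.of_compactSpace φ)
    have hre := hconv _ (Complex.continuous_re.comp hφ) x
    have him := hconv _ (Complex.continuous_im.comp hφ) x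
    have h := (Complex.continuous_ofReal.tendsto _).comp hre |>.add
      (((Complex.continuous_ofReal.tendsto _).comp him).mul_const Complex.I)
    have e1 := map_transfer_iterate f Complex.reCLM φ
    have e2 := map_transfer_iterate f Complex.imCLM φ
    convert h using 2 with m
    · have e1 := congrFun (e1 m) x
      have e2 := congrFun (e2 m) x
      simp only [Function.comp_apply, Complex.reCLM_apply, Complex.imCLM_apply] at e1 e2 ⊢
      rw [← Complex.re_add_im ((transfer f)^[m] φ x), e1, e2]
      rfl
    · exact (integral_re_add_im hi).symm

end IteratedFunctionSystem


/-! ### The polynomial in w over a finite z -/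

section Slice

theorem slice_coe_eq_aeval (R : MvPolynomial (Fin 2) ℂ) (z : ℂ) :
    slice R z = MvPolynomial.aeval ![Polynomial.C z, Polynomial.X] R := by
  change (asPolyInZ R).eval (Polynomial.C z) = _
  unfold asPolyInZ
  induction R using MvPolynomial.induction_on with
  | C a => simp [Polynomial.algebraMap_apply]
  | add p q hp hq => simp only [map_add, Polynomial.eval_add, hp, hq]
  | mul_X p i hp =>
    rw [map_mul, Polynomial.eval_mul, hp, map_mul]
    fin_cases i <;> simp

theorem eval_slice (R : MvPolynomial (Fin 2) ℂ) (z w : ℂ) :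
    (slice R z).eval w = MvPolynomial.eval ![z, w] R := by
  rw [slice_coe_eq_aeval]
  induction R using MvPolynomial.induction_on with
  | C a => simp
  | add p q hp hq => simp only [map_add, Polynomial.eval_add, hp, hq]
  | mul_X p i hp =>
    rw [map_mul, Polynomial.eval_mul, hp, map_mul]
    fin_cases i <;> simp

theorem slice_perturbed (R₀ : ℂ[X]) (P : MvPolynomial (Fin 2) ℂ) (δ z : ℂ) :
    slice (perturbed R₀ P δ) z = R₀ + Polynomial.C δ * slice P z := by
  simp only [slice_coe_eq_aeval, perturbed, map_add, map_mul, ← Polynomial.aeval_algHom_apply,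
    MvPolynomial.aeval_X]
  simp

theorem slice_eq_sum (P : MvPolynomial (Fin 2) ℂ) (z : ℂ) :
    slice P z = ∑ m ∈ P.support,
      Polynomial.C (P.coeff m * z ^ m 0) * Polynomial.X ^ m 1 := by
  rw [slice_coe_eq_aeval, MvPolynomial.aeval_def, MvPolynomial.eval₂_eq']
  refine Finset.sum_congr rfl fun m _ => ?_
  simp [Fin.prod_univ_two, mul_assoc]

theorem add_le_of_mem_support {P : MvPolynomial (Fin 2) ℂ} {d : ℕ} (hP : P.totalDegree ≤ d)
    {m : Fin 2 →₀ ℕ} (hm : m ∈ P.support) : m 0 + m 1 ≤ d := by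
  have h := (MvPolynomial.le_totalDegree hm).trans hP
  rwa [Finsupp.sum_fintype _ _ (fun _ => rfl), Fin.sum_univ_two] at h

theorem natDegree_slice_le {P : MvPolynomial (Fin 2) ℂ} {d : ℕ} (hP : P.totalDegree ≤ d) (z : ℂ) :
    (slice P z).natDegree ≤ d := by
  rw [slice_eq_sum]
  refine Polynomial.natDegree_sum_le_of_forall_le _ _ fun m hm => ?_
  refine (Polynomial.natDegree_C_mul_X_pow_le _ _).trans ?_
  have := add_le_of_mem_support hP hm
  omega

/-- A monomial z^i w^d of total degree at most d has i = 0. This is what keeps roots from escaping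
to ∞. -/
theorem coeff_slice {P : MvPolynomial (Fin 2) ℂ} {d : ℕ} (hP : P.totalDegree ≤ d) (z : ℂ) :
    (slice P z).coeff d = (slice P ((0 : ℂ) : Sphere)).coeff d := by
  rw [slice_eq_sum, slice_eq_sum, Polynomial.finsetSum_coeff,
    Polynomial.finsetSum_coeff]
  refine Finset.sum_congr rfl fun m hm => ?_
  have := add_le_of_mem_support hP hm
  rw [Polynomial.coeff_C_mul_X_pow, Polynomial.coeff_C_mul_X_pow]
  split_ifs with h
  · have h0 : m 0 = 0 := by omega
    simp [h0]
  · rfl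

theorem degreeOf_perturbed_le {R₀ : ℂ[X]} {P : MvPolynomial (Fin 2) ℂ} {d : ℕ}
    (hR₀ : R₀.natDegree ≤ d) (hP : P.totalDegree ≤ d) (δ : ℂ) :
    (perturbed R₀ P δ).degreeOf 1 ≤ d := by
  refine (MvPolynomial.degreeOf_add_le _ _ _).trans (max_le ?_ ?_)
  · refine (MvPolynomial.degreeOf_le_totalDegree _ _).trans ?_
    rw [Polynomial.aeval_eq_sum_range]
    refine MvPolynomial.totalDegree_finsetSum_le fun i hi => ?_
    refine (MvPolynomial.totalDegree_smul_le _ _).trans ?_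
    rw [MvPolynomial.totalDegree_X_pow]
    have := Finset.mem_range.1 hi
    omega
  · exact (MvPolynomial.degreeOf_C_mul_le _ _ _).trans
      ((MvPolynomial.degreeOf_le_totalDegree _ _).trans hP)

end Slice

/-! ### Bounds on polynomials and their roots -/

section Estimates

theorem exists_norm_eval_le {P : MvPolynomial (Fin 2) ℂ} {d : ℕ} (hP : P.totalDegree ≤ d) :
    ∃ C > 0, ∀ N : ℝ, 1 ≤ N → ∀ z w : ℂ, ‖z‖ ≤ N → ‖w‖ ≤ N →
      ‖MvPolynomial.eval ![z, w] P‖ ≤ C * N ^ d := by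
  -- The summand 1 keeps the constant positive when `P` is zero.
  refine ⟨∑ m ∈ P.support, ‖P.coeff m‖ + 1, by positivity, fun N hN z w hz hw => ?_⟩
  rw [MvPolynomial.eval_eq']
  have h1 : ‖∑ m ∈ P.support, P.coeff m * ∏ i, ![z, w] i ^ m i‖
      ≤ ∑ m ∈ P.support, ‖P.coeff m‖ * N ^ d := by
    refine (norm_sum_le _ _).trans (Finset.sum_le_sum fun m hm => ?_)
    rw [norm_mul, Fin.prod_univ_two]
    gcongr
    simp only [Matrix.cons_val_zero, Matrix.cons_val_one, norm_mul, norm_pow]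
    calc ‖z‖ ^ m 0 * ‖w‖ ^ m 1 ≤ N ^ m 0 * N ^ m 1 := by gcongr
      _ = N ^ (m 0 + m 1) := (pow_add _ _ _).symm
      _ ≤ N ^ d := pow_le_pow_right₀ hN (add_le_of_mem_support hP hm)
  rw [← Finset.sum_mul] at h1
  refine h1.trans ?_
  gcongr
  linarith

theorem exists_lipschitz_eval (P : MvPolynomial (Fin 2) ℂ) (N : ℝ) :
    ∃ L : ℝ, 0 < L ∧ ∀ z z' w w' : ℂ, ‖z‖ ≤ N → ‖z'‖ ≤ N → ‖w‖ ≤ N → ‖w'‖ ≤ N →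
      ‖MvPolynomial.eval ![z, w] P - MvPolynomial.eval ![z', w'] P‖ ≤
        L * (‖z - z'‖ + ‖w - w'‖) := by
  induction P using MvPolynomial.induction_on with
  | C a => exact ⟨1, one_pos, fun z z' w w' _ _ _ _ => by simp; positivity⟩
  | add p q hp hq =>
    obtain ⟨L, hL, h⟩ := hp
    obtain ⟨L', hL', h'⟩ := hq
    refine ⟨L + L', by positivity, fun z z' w w' h1 h2 h3 h4 => ?_⟩
    rw [map_add, map_add, add_sub_add_comm, add_mul]
    exact (norm_add_le _ _).trans (add_le_add (h z z' w w' h1 h2 h3 h4) (h' z z' w w' h1 h2 h3 h4))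
  | mul_X p i hp =>
    obtain ⟨L, hL, h⟩ := hp
    obtain ⟨C, hC, hp⟩ := exists_norm_eval_le (P := p) le_rfl
    set B := C * (max N 1) ^ p.totalDegree
    have hB : 0 < B := by positivity
    refine ⟨L * (max N 1) + B, by positivity, fun z z' w w' h1 h2 h3 h4 => ?_⟩
    have hpB : ‖MvPolynomial.eval ![z', w'] p‖ ≤ B :=
      hp _ (le_max_right _ _) _ _ (h2.trans (le_max_left _ _)) (h4.trans (le_max_left _ _))
    have hX : ‖![z, w] i‖ ≤ max N 1 ∧ ‖![z, w] i - ![z', w'] i‖ ≤ ‖z - z'‖ + ‖w - w'‖ := by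
      fin_cases i <;> simp [h1, h3]
    rw [map_mul, map_mul, MvPolynomial.eval_X, MvPolynomial.eval_X]
    set a := MvPolynomial.eval ![z, w] p
    set a' := MvPolynomial.eval ![z', w'] p
    calc ‖a * ![z, w] i - a' * ![z', w'] i‖
        = ‖(a - a') * ![z, w] i + a' * (![z, w] i - ![z', w'] i)‖ := by ring_nf
      _ ≤ ‖a - a'‖ * ‖![z, w] i‖ + ‖a'‖ * ‖![z, w] i - ![z', w'] i‖ := by
        rw [← norm_mul, ← norm_mul]; exact norm_add_le _ _
      _ ≤ (L * (‖z - z'‖ + ‖w - w'‖)) * max N 1 + B * (‖z - z'‖ + ‖w - w'‖) := by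
        gcongr
        · exact h z z' w w' h1 h2 h3 h4
        · exact hX.1
        · exact hX.2
      _ = _ := by ring

/-- Each factor satisfies |w - a| ≥ |w|/2 once |w| ≥ 2|a|. -/
theorem exists_pow_le_norm_prod (s : Multiset ℂ) :
    ∃ ρ : ℝ, ∀ w : ℂ, ρ ≤ ‖w‖ → (‖w‖ / 2) ^ s.card ≤ ‖(s.map fun ζ => w - ζ).prod‖ := by
  induction s using Multiset.induction with
  | empty => exact ⟨0, by simp⟩
  | cons a s ih =>
    obtain ⟨ρ, h⟩ := ih
    refine ⟨max ρ (2 * ‖a‖), fun w hw => ?_⟩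
    rw [Multiset.map_cons, Multiset.prod_cons, Multiset.card_cons, pow_succ', norm_mul]
    have h1 := (le_max_left _ _).trans hw
    have h2 := (le_max_right _ _).trans hw
    gcongr
    · have := norm_sub_norm_le w a
      linarith
    · exact h w h1

theorem eval_eq_prod_roots (p : ℂ[X]) (w : ℂ) :
    p.eval w = p.leadingCoeff * (p.roots.map fun ζ => w - ζ).prod := by
  conv_lhs => rw [(IsAlgClosed.splits p).eq_prod_roots]
  simp [Polynomial.eval_multiset_prod]

/-- Roots of the perturbed polynomial lie in the disc of radius `max r ‖z‖ / 2`. -/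
theorem exists_norm_root_le {d : ℕ} {R₀ : ℂ[X]} (hR₀ : R₀.natDegree = d) (h0 : R₀ ≠ 0)
    {P : MvPolynomial (Fin 2) ℂ} (hP : P.totalDegree ≤ d) :
    ∃ r₀ : ℝ, ∀ r ≥ r₀, ∃ Δ > 0, ∀ δ : ℂ, ‖δ‖ < Δ → ∀ z w : ℂ,
      MvPolynomial.eval ![z, w] (perturbed R₀ P δ) = 0 → ‖w‖ ≤ max r ‖z‖ / 2 := by
  obtain ⟨ρ, hρ⟩ := exists_pow_le_norm_prod R₀.roots
  obtain ⟨C, hC, hPC⟩ := exists_norm_eval_le hP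
  have hcard : R₀.roots.card = d := by rw [← (IsAlgClosed.splits R₀).natDegree_eq_card_roots, hR₀]
  have hc : 0 < ‖R₀.leadingCoeff‖ := by simpa using h0
  -- If |w| > max(r, |z|)/2, then |z| and |w| are at most 2|w|, so |c| (|w|/2)^d ≤ |R₀(w)| = |δ P(z,
  -- w)| ≤ |δ| C (2|w|)^d with c the leading coefficient; this Δ excludes that.
  refine ⟨max (2 * ρ) 1, fun r hr => ⟨‖R₀.leadingCoeff‖ / 2 ^ d / (C * 2 ^ d), by positivity,
    fun δ hδ z w hzw => ?_⟩⟩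
  by_contra! hlt
  have hr1 := (le_max_right _ _).trans hr
  have hr2 := (le_max_left _ _).trans hr
  have hm1 := le_max_left r ‖z‖
  have hm2 := le_max_right r ‖z‖
  have hw : 0 < ‖w‖ := by linarith
  have h1 := hρ w (by linarith)
  have h2 := hPC (2 * ‖w‖) (by linarith) z w (by linarith) (by linarith)
  rw [← eval_slice, slice_perturbed, Polynomial.eval_add, Polynomial.eval_mul, Polynomial.eval_C,
    eval_slice, eval_eq_prod_roots, add_eq_zero_iff_eq_neg] at hzw
  have h3 := congrArg norm hzw
  rw [norm_neg, norm_mul, norm_mul] at h3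
  rw [hcard] at h1
  have h4 : ‖R₀.leadingCoeff‖ * (‖w‖ / 2) ^ d ≤ ‖δ‖ * (C * (2 * ‖w‖) ^ d) :=
    calc _ ≤ _ := by gcongr
      _ = _ := h3
      _ ≤ _ := by gcongr
  rw [lt_div_iff₀ (by positivity)] at hδ
  have h5 : ‖δ‖ * (C * 2 ^ d) * ‖w‖ ^ d < ‖R₀.leadingCoeff‖ / 2 ^ d * ‖w‖ ^ d := by gcongr
  rw [div_pow, mul_pow] at h4
  have : ‖R₀.leadingCoeff‖ / 2 ^ d * ‖w‖ ^ d = ‖R₀.leadingCoeff‖ * (‖w‖ ^ d / 2 ^ d) := by ring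
  nlinarith

/-- Near a simple zero a polynomial expands distances at a definite rate. -/
theorem exists_antilipschitz_near_simple_root {p : ℂ[X]} {ζ : ℂ} (h0 : p ≠ 0)
    (hζ : p.rootMultiplicity ζ = 1) :
    ∃ κ > 0, ∀ᶠ η in 𝓝[>] (0 : ℝ), ∀ w w' : ℂ, dist ζ w < η → dist ζ w' < η →
      κ * ‖w - w'‖ ≤ ‖p.eval w - p.eval w'‖ := by
  have hroot : p.IsRoot ζ := (Polynomial.rootMultiplicity_pos h0).1 (by omega)
  have hd : p.derivative.eval ζ ≠ 0 := fun h => by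
    have := (Polynomial.one_lt_rootMultiplicity_iff_isRoot h0).2 ⟨hroot, h⟩
    omega
  have hpos : 0 < ‖p.derivative.eval ζ‖ := norm_pos_iff.2 hd
  refine ⟨‖p.derivative.eval ζ‖ / 2, by positivity, ?_⟩
  -- Strict differentiability is needed because both w and w' vary; the error is at most half the
  -- derivative.
  have h := (p.hasStrictDerivAt ζ).hasStrictFDerivAt.isLittleO.bound (half_pos hpos)
  obtain ⟨e, he, hball⟩ := Metric.eventually_nhds_iff.1 h
  filter_upwards [Ioo_mem_nhdsGT he] with η hη w w' hw hw'
  have := hball (y := (w, w')) (by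
    rw [Prod.dist_eq]
    exact max_lt (by rw [dist_comm]; exact hw.trans hη.2) (by rw [dist_comm]; exact hw'.trans hη.2))
  simp only [ContinuousLinearMap.toSpanSingleton_apply, smul_eq_mul] at this
  have h2 := norm_sub_norm_le ((w - w') * p.derivative.eval ζ) (p.eval w - p.eval w')
  rw [norm_sub_rev _ (p.eval w - _), norm_mul] at h2
  linarith

end Estimates


/-! ### The contracting branches near the zeros -/

section Branches

/-- Used in contrapositive form: a polynomial that is small at ζ has a root near ζ. -/
theorem pow_card_le_norm_prod {s : Multiset ℂ} {ζ : ℂ} {η : ℝ} (hη : 0 ≤ η)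
    (h : ∀ w ∈ s, η ≤ ‖ζ - w‖) : η ^ s.card ≤ ‖(s.map fun w => ζ - w).prod‖ := by
  induction s using Multiset.induction with
  | empty => simp
  | cons a s ih =>
    rw [Multiset.map_cons, Multiset.prod_cons, Multiset.card_cons, pow_succ', norm_mul]
    gcongr
    · exact h a (Multiset.mem_cons_self _ _)
    · exact ih fun w hw => h w (Multiset.mem_cons_of_mem hw)

/-- If all the pairwise disjoint balls `B (c i) η` meet the multiset `s`, and there are as many
balls as elements of `s`, then each ball contains exactly one element of `s`. -/
theorem exists_eq_map_of_mem_balls {X ι : Type*} [PseudoMetricSpace X] [Fintype ι] {c : ι → X}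
    {η : ℝ} (hsep : ∀ i j, i ≠ j → 2 * η ≤ dist (c i) (c j)) {s : Multiset X}
    (hcard : s.card ≤ Fintype.card ι) (h : ∀ i, ∃ w ∈ s, dist (c i) w < η) :
    ∃ g : ι → X, (∀ i, dist (c i) (g i) < η) ∧ s = Finset.univ.val.map g := by
  choose g hg hd using h
  refine ⟨g, hd, (Multiset.eq_of_le_of_card_le ?_ (by simpa using hcard)).symm⟩
  have hinj : Function.Injective g := fun i j hij => by
    by_contra hne
    have h1 := hsep i j hne
    have h2 := dist_triangle_right (c i) (c j) (g i)
    have h3 := hd i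
    have h4 := hd j
    rw [← hij] at h4
    linarith
  rw [Multiset.le_iff_subset (Finset.univ.nodup.map hinj)]
  intro x hx
  obtain ⟨i, -, rfl⟩ := Multiset.mem_map.1 hx
  exact hg i

variable {d : ℕ} {R₀ : ℂ[X]} {P : MvPolynomial (Fin 2) ℂ}

theorem slice_perturbed_natDegree (hR₀ : R₀.natDegree = d) (hP : P.totalDegree ≤ d) {δ : ℂ}
    (h0 : R₀ ≠ 0)
    (hδ : ‖δ‖ * ‖(slice P ((0 : ℂ) : Sphere)).coeff d‖ ≤ ‖R₀.leadingCoeff‖ / 2) (z : ℂ) :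
    (slice (perturbed R₀ P δ) z).natDegree = d ∧
      ‖R₀.leadingCoeff‖ / 2 ≤ ‖(slice (perturbed R₀ P δ) z).leadingCoeff‖ := by
  have hc : 0 < ‖R₀.leadingCoeff‖ := by simpa using h0
  have hcoeff : (slice (perturbed R₀ P δ) z).coeff d =
      R₀.leadingCoeff + δ * (slice P ((0 : ℂ) : Sphere)).coeff d := by
    rw [slice_perturbed, Polynomial.coeff_add, Polynomial.coeff_C_mul, coeff_slice hP,
      Polynomial.leadingCoeff, hR₀]
  have hle : ‖R₀.leadingCoeff‖ / 2 ≤ ‖(slice (perturbed R₀ P δ) z).coeff d‖ := by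
    rw [hcoeff]
    have := norm_sub_le_norm_add R₀.leadingCoeff (δ * (slice P ((0 : ℂ) : Sphere)).coeff d)
    rw [norm_mul] at this
    linarith
  have hdeg : (slice (perturbed R₀ P δ) z).natDegree = d := by
    refine le_antisymm ?_ (Polynomial.le_natDegree_of_ne_zero
      (norm_pos_iff.1 ((half_pos hc).trans_le hle)))
    rw [slice_perturbed]
    exact Polynomial.natDegree_add_le_of_degree_le hR₀.le
      ((Polynomial.natDegree_C_mul_le _ _).trans (natDegree_slice_le hP z))
  refine ⟨hdeg, ?_⟩
  rwa [← hdeg] at hle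

/-- For small `δ` the correspondence maps a disc into itself, and there it is the union of `d`
contractions with images near the zeros of `R₀`; outside the disc it decreases the norm. -/
theorem exists_contracting_branches (hR₀ : R₀.natDegree = d) (h0 : R₀ ≠ 0)
    (hsimple : ∀ ζ : ℂ, R₀.IsRoot ζ → R₀.rootMultiplicity ζ = 1)
    (hP : P.totalDegree ≤ d) {ε : ℝ} (hε : 0 < ε) :
    ∃ r > 0, ∃ Δ > 0, ∀ δ : ℂ, ‖δ‖ < Δ →
      (∀ z w : ℂ, MvPolynomial.eval ![z, w] (perturbed R₀ P δ) = 0 → ‖w‖ ≤ max r ‖z‖ / 2) ∧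
      (∀ z : ℂ, slice (perturbed R₀ P δ) z ≠ 0 ∧
        (slice (perturbed R₀ P δ) z).natDegree = d) ∧
      ∃ g : R₀.roots.toFinset → Metric.closedBall (0 : ℂ) r → Metric.closedBall (0 : ℂ) r,
        (∀ ζ, LipschitzWith (1 / 2) (g ζ)) ∧ (∀ ζ z, dist (g ζ z : ℂ) ζ < ε) ∧
        ∀ z : Metric.closedBall (0 : ℂ) r, (slice (perturbed R₀ P δ) (z : ℂ)).roots =
          Finset.univ.val.map fun ζ => (g ζ z : ℂ) := by
  classical
  obtain ⟨r₀, hr₀⟩ := exists_norm_root_le hR₀ h0 hP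
  set r := max r₀ 1 with hr
  have hr1 : 1 ≤ r := le_max_right _ _
  obtain ⟨Δ₁, hΔ₁, hroot⟩ := hr₀ r (le_max_left _ _)
  obtain ⟨C, hC, hPC⟩ := exists_norm_eval_le hP
  obtain ⟨L, hL, hPL⟩ := exists_lipschitz_eval P r
  have hc : 0 < ‖R₀.leadingCoeff‖ := by simpa using h0
  have hcard : Fintype.card R₀.roots.toFinset = d := by
    rw [Fintype.card_coe, Multiset.toFinset_card_of_nodup,
      ← (IsAlgClosed.splits R₀).natDegree_eq_card_roots, hR₀]
    refine Multiset.nodup_iff_count_le_one.2 fun ζ => ?_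
    rw [Polynomial.count_roots]
    by_cases hζ : R₀.IsRoot ζ
    · exact (hsimple ζ hζ).le
    · rw [Polynomial.rootMultiplicity_eq_zero hζ]; exact zero_le_one
  have hmem : ∀ ζ : R₀.roots.toFinset, R₀.IsRoot ζ := fun ζ =>
    Polynomial.isRoot_of_mem_roots (Multiset.mem_toFinset.1 ζ.2)
  choose κ hκ hexp using fun ζ : R₀.roots.toFinset =>
    exists_antilipschitz_near_simple_root h0 (hsimple ζ (hmem ζ))
  have hzero : ∀ ζ : R₀.roots.toFinset, ‖(ζ : ℂ)‖ ≤ r := fun ζ => by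
    -- The zeros of `R₀` are the roots for δ = 0, so the bound on roots applies to them.
    have := hroot 0 (by simpa using hΔ₁) 0 ζ (by
      rw [← eval_slice, slice_perturbed]; simpa using hmem ζ)
    rw [norm_zero, max_eq_left (by linarith)] at this
    linarith
  have hsmall : ∀ (a b : ℝ), 0 < b → ∀ᶠ t in 𝓝[>] (0 : ℝ), a * t < b := fun a b hb => by
    have : Tendsto (fun t : ℝ => a * t) (𝓝 0) (𝓝 0) := by
      simpa using (continuous_const_mul a).tendsto (0 : ℝ)
    exact (this.mono_left nhdsWithin_le_nhds).eventually (gt_mem_nhds hb)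
  -- The η-balls about the zeros lie in the ε-balls, in the regions where `R₀` expands, and are
  -- pairwise disjoint.
  obtain ⟨η, hη, hηε, hηexp, hηsep⟩ := (eventually_mem_nhdsWithin.and ((hsmall 1 ε hε).and
    ((eventually_all.2 hexp).and (eventually_all.2 fun ζ : R₀.roots.toFinset =>
      eventually_all.2 fun ζ' : R₀.roots.toFinset =>
        show ∀ᶠ t in 𝓝[>] (0 : ℝ), ζ ≠ ζ' → 2 * t < dist (ζ : ℂ) ζ' from by
          by_cases h : ζ = ζ'
          · simp [h]
          · simpa [h] using hsmall 2 _ (dist_pos.2 (Subtype.coe_ne_coe.2 h)))))).exists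
  have hη : 0 < η := hη
  -- The three conditions give, in order, contraction, a leading coefficient that stays away from 0,
  -- and a root in each η-ball.
  obtain ⟨Δ₂, hΔ₂, hΔκ, hΔc, hΔB⟩ := (eventually_mem_nhdsWithin.and
    ((eventually_all.2 fun ζ => hsmall L (κ ζ / 3) (by have := hκ ζ; positivity)).and
    ((hsmall ‖(slice P ((0 : ℂ) : Sphere)).coeff d‖ (‖R₀.leadingCoeff‖ / 2) (by positivity)).and
      (hsmall (C * r ^ d) (‖R₀.leadingCoeff‖ / 2 * η ^ d) (by positivity))))).exists
  have hΔ₂ : 0 < Δ₂ := hΔ₂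
  refine ⟨r, by positivity, min Δ₁ Δ₂, lt_min hΔ₁ hΔ₂, fun δ hδ => ?_⟩
  have hδ₁ : ‖δ‖ < Δ₁ := hδ.trans_le (min_le_left _ _)
  have hδ₂ : ‖δ‖ < Δ₂ := hδ.trans_le (min_le_right _ _)
  have hroot := hroot δ hδ₁
  have hdeg := slice_perturbed_natDegree hR₀ hP h0 (δ := δ) (by
    refine le_trans ?_ hΔc.le
    rw [mul_comm]
    gcongr)
  have hne : ∀ z : ℂ, slice (perturbed R₀ P δ) z ≠ 0 := fun z h => by
    have := (hdeg z).2
    rw [h, Polynomial.leadingCoeff_zero, norm_zero] at this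
    linarith
  refine ⟨hroot, fun z => ⟨hne z, (hdeg z).1⟩, ?_⟩
  have heval : ∀ z w : ℂ, (slice (perturbed R₀ P δ) z).eval w =
      R₀.eval w + δ * MvPolynomial.eval ![z, w] P := fun z w => by
    rw [slice_perturbed, Polynomial.eval_add, Polynomial.eval_mul, Polynomial.eval_C, eval_slice]
  have hbranch : ∀ z : Metric.closedBall (0 : ℂ) r, ∃ g : R₀.roots.toFinset → ℂ,
      (∀ ζ : R₀.roots.toFinset, dist (ζ : ℂ) (g ζ) < η) ∧
      (slice (perturbed R₀ P δ) (z : ℂ)).roots = Finset.univ.val.map g := by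
    intro z
    have hz : ‖(z : ℂ)‖ ≤ r := mem_closedBall_zero_iff.1 z.2
    have hcr : (slice (perturbed R₀ P δ) (z : ℂ)).roots.card = d := by
      rw [← (IsAlgClosed.splits _).natDegree_eq_card_roots, (hdeg z).1]
    refine exists_eq_map_of_mem_balls (fun i j hij => (hηsep i j hij).le) (by rw [hcr, hcard])
      fun ζ => ?_
    -- Otherwise the factorization bounds |R_δ(z, ζ)| below by |c| η^d / 2, with c the leading
    -- coefficient of `R₀`, while R_δ(z, ζ) = δ P(z, ζ) is smaller.
    by_contra! hfar
    have h1 := pow_card_le_norm_prod hη.le fun w hw => (hfar w hw).trans (dist_eq_norm _ _).le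
    have h2 := eval_eq_prod_roots (slice (perturbed R₀ P δ) (z : ℂ)) ζ
    rw [heval, (hmem ζ).eq_zero, zero_add] at h2
    have h3 := congrArg norm h2
    rw [norm_mul, norm_mul] at h3
    rw [hcr] at h1
    have h4 : ‖R₀.leadingCoeff‖ / 2 * η ^ d ≤ ‖δ‖ * (C * r ^ d) :=
      calc _ ≤ _ := mul_le_mul (hdeg z).2 h1 (by positivity) (by positivity)
        _ = _ := h3.symm
        _ ≤ _ := by
          gcongr
          exact hPC r hr1 z ζ hz (hzero ζ)
    have h5 : ‖δ‖ * (C * r ^ d) ≤ Δ₂ * (C * r ^ d) := by gcongr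
    linarith
  choose g hgη hg using hbranch
  have hgroot : ∀ z ζ, R₀.eval (g z ζ) + δ * MvPolynomial.eval ![(z : ℂ), g z ζ] P = 0 :=
    fun z ζ => by
      rw [← heval]
      refine Polynomial.isRoot_of_mem_roots ?_
      rw [hg]
      exact Multiset.mem_map_of_mem _ (Finset.mem_univ ζ)
  have hgr : ∀ z ζ, ‖g z ζ‖ ≤ r := fun z ζ => by
    have hz : ‖(z : ℂ)‖ ≤ r := mem_closedBall_zero_iff.1 z.2
    have := hroot z (g z ζ) (by rw [← eval_slice, heval, hgroot])
    rw [max_eq_left hz] at this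
    linarith
  refine ⟨fun ζ z => ⟨g z ζ, mem_closedBall_zero_iff.2 (hgr z ζ)⟩, fun ζ => ?_, fun ζ z => ?_, hg⟩
  · refine LipschitzWith.of_dist_le_mul fun z z' => ?_
    rw [Subtype.dist_eq, Subtype.dist_eq, dist_eq_norm, dist_eq_norm]
    have h1 := hηexp ζ (g z ζ) (g z' ζ) (hgη z ζ) (hgη z' ζ)
    have h2 : R₀.eval (g z ζ) - R₀.eval (g z' ζ) = -(δ * (MvPolynomial.eval ![(z : ℂ), g z ζ] P -
        MvPolynomial.eval ![(z' : ℂ), g z' ζ] P)) := by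
      linear_combination hgroot z ζ - hgroot z' ζ
    rw [h2, norm_neg, norm_mul] at h1
    have h3 := hPL z z' (g z ζ) (g z' ζ) (mem_closedBall_zero_iff.1 z.2)
      (mem_closedBall_zero_iff.1 z'.2) (hgr z ζ) (hgr z' ζ)
    -- With 1/3 the bound |w - w'| ≤ (|z - z'| + |w - w'|)/3 follows, which rearranges to Lipschitz
    -- constant 1/2.
    have h4 : ‖δ‖ * L ≤ κ ζ / 3 := by
      refine le_trans ?_ (hΔκ ζ).le
      rw [mul_comm]
      gcongr
    have h5 : κ ζ * ‖g z ζ - g z' ζ‖ ≤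
        κ ζ * ((‖(z : ℂ) - z'‖ + ‖g z ζ - g z' ζ‖) / 3) :=
      calc _ ≤ _ := h1
        _ ≤ ‖δ‖ * (L * (‖(z : ℂ) - z'‖ + ‖g z ζ - g z' ζ‖)) := by gcongr
        _ = ‖δ‖ * L * (‖(z : ℂ) - z'‖ + ‖g z ζ - g z' ζ‖) := by ring
        _ ≤ κ ζ / 3 * (‖(z : ℂ) - z'‖ + ‖g z ζ - g z' ζ‖) := by gcongr
        _ = _ := by ring
    have h6 := le_of_mul_le_mul_left h5 (hκ ζ)
    push_cast
    linarith
  · rw [dist_comm]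
    exact (hgη z ζ).trans (by linarith)

end Branches


/-! ### Fibers, iterates and push-forwards on the sphere -/

section Correspondence

theorem fiber_coe {R : MvPolynomial (Fin 2) ℂ} {z : ℂ}
    (h : R.degreeOf 1 ≤ (slice R z).natDegree) :
    fiber R z = (slice R z).roots.map fun w : ℂ => (w : Sphere) := by
  rw [fiber, Nat.sub_eq_zero_of_le h, Multiset.replicate_zero, add_zero]
  simp [Multiset.bind_def, Multiset.pure_def]

/-- The closure adds no point over a finite z: over the unit disc about z all roots are bounded, so
that part of the affine curve lies in a compact set. -/
theorem mem_image_coe_iff {R : MvPolynomial (Fin 2) ℂ} {r : ℝ}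
    (hR : ∀ z w : ℂ, MvPolynomial.eval ![z, w] R = 0 → ‖w‖ ≤ max r ‖z‖ / 2) (z : ℂ) (w : Sphere) :
    w ∈ image R z ↔ ∃ w' : ℂ, MvPolynomial.eval ![z, w'] R = 0 ∧ w = w' := by
  constructor
  · intro h
    let T : Set (ℂ × ℂ) := {p | MvPolynomial.eval ![p.1, p.2] R = 0} ∩
      Metric.closedBall z 1 ×ˢ Metric.closedBall 0 (max r (‖z‖ + 1) / 2)
    let c : ℂ × ℂ → Sphere × Sphere := Prod.map (↑) (↑)
    have hc : Continuous c := OnePoint.continuous_coe.prodMap OnePoint.continuous_coe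
    have hev : Continuous fun p : ℂ × ℂ => MvPolynomial.eval ![p.1, p.2] R := by
      refine (MvPolynomial.continuous_eval R).comp (continuous_pi fun i => ?_)
      fin_cases i
      · exact continuous_fst
      · exact continuous_snd
    have hT : IsCompact T :=
      ((isCompact_closedBall _ _).prod (isCompact_closedBall _ _)).inter_left
        (isClosed_eq hev continuous_const)
    have hG : IsOpen (((↑) '' Metric.ball z 1 : Set Sphere) ×ˢ (Set.univ : Set Sphere)) :=
      (OnePoint.isOpen_image_coe.2 Metric.isOpen_ball).prod isOpen_univ
    have hmem : ((z : Sphere), w) ∈ closure (c '' T) := by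
      refine closure_mono ?_ (hG.inter_closure
        ⟨⟨Set.mem_image_of_mem _ (Metric.mem_ball_self one_pos), trivial⟩, h⟩)
      rintro _ ⟨⟨⟨z', hz', hzz⟩, -⟩, z'', w'', h0, rfl⟩
      obtain rfl := OnePoint.coe_injective hzz
      refine ⟨(z', w''), ⟨h0, Metric.ball_subset_closedBall hz', ?_⟩, rfl⟩
      refine mem_closedBall_zero_iff.2 ((hR _ _ h0).trans ?_)
      have h1 := norm_sub_norm_le z' z
      have h2 := mem_ball_iff_norm.1 hz'
      gcongr
      linarith
    obtain ⟨⟨z', w'⟩, ⟨h0, -⟩, heq⟩ := (hT.image hc).isClosed.closure_subset hmem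
    obtain ⟨h1, rfl⟩ := Prod.mk.inj heq
    obtain rfl := OnePoint.coe_injective h1
    exact ⟨w', h0, rfl⟩
  · rintro ⟨w', h0, rfl⟩
    exact subset_closure ⟨z, w', h0, rfl⟩

/-- `iter` appends a last step; the recursion for averages needs the first step split off. -/
theorem iter_succ_eq_bind (F : Sphere → Multiset Sphere) (m : ℕ) (a : Sphere) :
    iter F (m + 1) a = (F a).bind (iter F m) := by
  induction m with
  | zero =>
    change ({a} : Multiset Sphere).bind F = (F a).bind fun x => {x}
    rw [Multiset.singleton_bind, Multiset.bind_singleton, Multiset.map_id']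
  | succ m ih =>
    change (iter F (m + 1) a).bind F = _
    rw [ih, Multiset.bind_assoc]
    rfl

/-- No measurability of F is needed: for a Dirac measure the integrand is almost everywhere
constant. -/
theorem pushforward_dirac (F : Sphere → Multiset Sphere) (a : Sphere) :
    pushforward F (Measure.dirac a) = ((F a).map Measure.dirac).sum := by
  have h : (fun x => ((F x).map Measure.dirac).sum) =ᵐ[Measure.dirac a]
      fun _ => ((F a).map Measure.dirac).sum := by
    rw [EventuallyEq, ae_dirac_eq]; exact rfl
  rw [pushforward, Measure.bind_congr_right h, Measure.dirac_bind measurable_const]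

theorem integral_multiset_sum_dirac (s : Multiset Sphere) (φ : C(Sphere, ℂ)) :
    Integrable φ (s.map Measure.dirac).sum ∧
      ∫ x, φ x ∂(s.map Measure.dirac).sum = (s.map φ).sum := by
  induction s using Multiset.induction with
  | empty => simp
  | cons a s ih =>
    have ha : Integrable φ (Measure.dirac a) := integrable_dirac (by simp)
    simp only [Multiset.map_cons, Multiset.sum_cons]
    exact ⟨ha.add_measure ih.1, by rw [integral_add_measure ha ih.1, integral_dirac, ih.2]⟩

/-- The integral of `φ` with respect to `d⁻ᵐ (Fᵐ)_* δ_a`. -/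
noncomputable def iterAverage (F : Sphere → Multiset Sphere) (d : ℕ) (φ : Sphere → ℂ) (m : ℕ)
    (a : Sphere) : ℂ :=
  ((d : ℂ) ^ m)⁻¹ * ((iter F m a).map φ).sum

theorem integral_pushforward_iter (F : Sphere → Multiset Sphere) (d : ℕ) (φ : C(Sphere, ℂ))
    (m : ℕ) (a : Sphere) :
    ∫ x, φ x ∂(((d : ℝ≥0∞) ^ m)⁻¹ • pushforward (iter F m) (Measure.dirac a)) =
      iterAverage F d φ m a := by
  rw [integral_smul_measure, pushforward_dirac, (integral_multiset_sum_dirac _ φ).2, iterAverage,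
    Complex.real_smul]
  simp

theorem iterAverage_succ (F : Sphere → Multiset Sphere) (d : ℕ) (φ : Sphere → ℂ) (m : ℕ)
    (a : Sphere) :
    iterAverage F d φ (m + 1) a = (d : ℂ)⁻¹ * ((F a).map (iterAverage F d φ m)).sum := by
  unfold iterAverage
  rw [iter_succ_eq_bind, Multiset.map_bind, Multiset.sum_bind, Multiset.sum_map_mul_left, pow_succ',
    mul_inv, mul_assoc]

theorem tendsto_iterAverage_of_fiber {F : Sphere → Multiset Sphere} {d : ℕ} (hd : d ≠ 0)
    {φ : Sphere → ℂ} {a : Sphere} {c : ℂ} (hcard : (F a).card = d)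
    (h : ∀ x ∈ F a, Tendsto (fun m => iterAverage F d φ m x) atTop (𝓝 c)) :
    Tendsto (fun m => iterAverage F d φ m a) atTop (𝓝 c) := by
  rw [← tendsto_add_atTop_iff_nat 1]
  simp_rw [iterAverage_succ]
  have h1 : Tendsto (fun m => ((F a).map fun x => iterAverage F d φ m x).sum) atTop
      (𝓝 ((F a).map fun _ => c).sum) := tendsto_multiset_sum _ h
  have h2 := h1.const_mul (d : ℂ)⁻¹
  rwa [Multiset.map_const', Multiset.sum_replicate, hcard, nsmul_eq_mul,
    inv_mul_cancel_left₀ (Nat.cast_ne_zero.2 hd)] at h2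

/-! ### Iterated function systems embedded in the sphere -/

variable {X ι : Type*} [Fintype ι]

theorem iterAverage_eq_transfer {F : Sphere → Multiset Sphere} {j : X → Sphere} {g : ι → X → X}
    (hF : ∀ x, F (j x) = Finset.univ.val.map fun i => j (g i x)) (φ : Sphere → ℂ) (m : ℕ) (x : X) :
    iterAverage F (Fintype.card ι) φ m (j x) = (transfer g)^[m] (φ ∘ j) x := by
  induction m generalizing x with
  | zero => simp [iterAverage, iter]
  | succ m ih =>
    rw [iterAverage_succ, hF, Function.iterate_succ_apply', Multiset.map_map, transfer,
      Complex.real_smul]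
    simp only [Function.comp_apply, ih]
    push_cast
    rfl

/-- The complement of all the images has empty preimage under each map. -/
theorem ae_mem_iUnion_range [MeasurableSpace X] {g : ι → X → X} (hg : ∀ i, Measurable (g i)) {μ : Measure X}
    {c : ℝ≥0∞} (hc : c ≠ 0) (hμ : ∑ i, μ.map (g i) = c • μ)
    (hs : MeasurableSet (⋃ i, Set.range (g i))) : (⋃ i, Set.range (g i)) ∈ ae μ := by
  have h : (c • μ) (⋃ i, Set.range (g i))ᶜ = 0 := by
    rw [← hμ, Measure.finsetSum_apply]
    refine Finset.sum_eq_zero fun i _ => ?_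
    rw [Measure.map_apply (hg i) hs.compl]
    convert! measure_empty (μ := μ)
    ext x
    simp
  rw [Measure.smul_apply, smul_eq_mul, mul_eq_zero] at h
  exact h.resolve_left hc

theorem pushforward_map_eq_smul [MeasurableSpace X] {F : Sphere → Multiset Sphere} {j : X → Sphere}
    (hj : MeasurableEmbedding j) {g : ι → X → X} (hg : ∀ i, Measurable (g i))
    (hF : ∀ x, F (j x) = Finset.univ.val.map fun i => j (g i x)) {μ : Measure X} {c : ℝ≥0∞}
    (hμ : ∑ i, μ.map (g i) = c • μ) :
    pushforward F (μ.map j) = c • μ.map j := by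
  -- F is controlled only on the range of j, where `μ.map j` lives, so measurable extensions of the
  -- branches replace it; `∞` only witnesses nonemptiness.
  choose h hh hhj using fun i => hj.exists_measurable_extend (hj.measurable.comp (hg i))
    fun _ => ⟨(∞ : Sphere)⟩
  have hG : Measurable fun y => ∑ i, Measure.dirac (h i y) :=
    Finset.measurable_sum _ fun i _ => Measure.measurable_dirac.comp (hh i)
  have hae : (fun y => ((F y).map Measure.dirac).sum) =ᵐ[μ.map j]
      fun y => ∑ i, Measure.dirac (h i y) := by
    rw [EventuallyEq, hj.ae_map_iff]
    refine Eventually.of_forall fun x => ?_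
    rw [hF, Multiset.map_map]
    exact Finset.sum_congr rfl fun i _ => congrArg Measure.dirac (congrFun (hhj i) x).symm
  ext s hs
  rw [pushforward, Measure.bind_congr_right hae, Measure.bind_apply hs hG.aemeasurable,
    hj.lintegral_map, Measure.smul_apply, Measure.map_apply hj.measurable hs, ← Measure.smul_apply,
    ← hμ, Measure.finsetSum_apply]
  simp_rw [Measure.finsetSum_apply]
  have hm : ∀ i, Measurable fun x => Measure.dirac (h i (j x)) s := fun i =>
    (Measure.measurable_coe hs).comp (Measure.measurable_dirac.comp ((hh i).comp hj.measurable))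
  rw [lintegral_finsetSum _ fun i _ => hm i]
  refine Finset.sum_congr rfl fun i _ => ?_
  rw [Measure.map_apply (hg i) (hj.measurable hs)]
  have e : ∀ x, Measure.dirac (h i (j x)) s = ((g i) ⁻¹' (j ⁻¹' s)).indicator 1 x := fun x => by
    rw [Measure.dirac_apply' _ hs, show h i (j x) = j (g i x) from congrFun (hhj i) x]
    rfl
  simp_rw [e]
  rw [lintegral_indicator_one (hg i (hj.measurable hs))]

variable [TopologicalSpace X] [MeasurableSpace X] [BorelSpace X]

/-- The support of an invariant measure of an iterated function system is mapped into itself. -/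
theorem mem_support_of_invariant {Y : Type*} [TopologicalSpace Y] [MeasurableSpace Y]
    [BorelSpace Y] {j : X → Y} (hj : IsEmbedding j) {g : ι → X → X}
    (hg : ∀ i, Continuous (g i)) {μ : Measure X} {c : ℝ≥0∞}
    (hμ : ∑ i, μ.map (g i) = c • μ) {x : X} (hx : j x ∈ (μ.map j).support) (i : ι) :
    j (g i x) ∈ (μ.map j).support := by
  rw [Measure.support_eq_forall_isOpen] at hx ⊢
  intro U hxU hU
  have hjm := hj.continuous.measurable
  -- Since j is an embedding, the open set of points that `g i` sends into `j ⁻¹' U` is the trace of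
  -- an open V.
  obtain ⟨V, hV, hVU⟩ := hj.isOpen_iff.1 ((hU.preimage hj.continuous).preimage (hg i))
  have hpos := hx V (by rw [← Set.mem_preimage, hVU]; exact hxU) hV
  rw [Measure.map_apply hjm hV.measurableSet, hVU,
    ← Measure.map_apply (hg i).measurable (hjm hU.measurableSet)] at hpos
  have hle : μ.map (g i) (j ⁻¹' U) ≤ c * μ (j ⁻¹' U) := by
    rw [← smul_eq_mul, ← Measure.smul_apply, ← hμ, Measure.finsetSum_apply]
    exact Finset.single_le_sum (f := fun i => μ.map (g i) (j ⁻¹' U)) (fun _ _ => zero_le)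
      (Finset.mem_univ i)
  rw [Measure.map_apply hjm hU.measurableSet]
  exact pos_of_ne_zero fun h => by simp [h] at hle; exact hpos.ne' hle

/-- A measure that annihilates all continuous functions vanishing on the closed set `S` has its
support in `S`. -/
theorem support_subset_of_integral_eq_zero {μ : Measure Sphere} [IsFiniteMeasure μ] {S : Set Sphere}
    (hS : IsClosed S) (h : ∀ φ : C(Sphere, ℂ), (∀ x ∈ S, φ x = 0) → ∫ x, φ x ∂μ = 0) :
    μ.support ⊆ S := by
  intro x hx
  by_contra hxS
  obtain ⟨φ, hφS, hφx, hφ⟩ := exists_continuous_zero_one_of_isClosed hS isClosed_singleton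
    (Set.disjoint_singleton_right.2 hxS)
  have h0 := h ⟨fun y => (φ y : ℂ), Complex.continuous_ofReal.comp φ.continuous⟩ fun y hy => by
    simpa using hφS hy
  have h1 : ∫ y, φ y ∂μ = 0 := by
    have : ((∫ y, φ y ∂μ : ℝ) : ℂ) = 0 := integral_complex_ofReal.symm.trans h0
    exact_mod_cast this
  have hint : Integrable φ μ :=
    φ.continuous.integrable_of_hasCompactSupport (HasCompactSupport.of_compactSpace φ)
  have hae := (integral_eq_zero_iff_of_nonneg (fun y => (hφ y).1) hint).1 h1
  refine ((Measure.mem_support_iff_forall x).1 hx {y | φ y ≠ 0}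
    ((isOpen_ne_fun φ.continuous continuous_const).mem_nhds ?_)).ne' hae
  have := hφx (Set.mem_singleton x)
  simp [this]

end Correspondence


/-! ### From the disc to all finite points -/

section Equilibrium

variable {R : MvPolynomial (Fin 2) ℂ} {d : ℕ} {r : ℝ}

/-- Outside the disc each step at least halves the norm, so induction on n with |a| ≤ 2^n r reaches
the disc; averaging over a fiber preserves a common limit. -/
theorem tendsto_iterAverage_of_closedBall (hd : d ≠ 0) (hr : 0 < r)
    (hR : ∀ z w : ℂ, MvPolynomial.eval ![z, w] R = 0 → ‖w‖ ≤ max r ‖z‖ / 2)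
    (hfib : ∀ z : ℂ, fiber R z = (slice R z).roots.map fun w : ℂ => (w : Sphere))
    (hdeg : ∀ z : ℂ, (slice R z).natDegree = d) {φ : Sphere → ℂ} {c : ℂ}
    (hball : ∀ z : ℂ, ‖z‖ ≤ r → Tendsto (fun m => iterAverage (fiber R) d φ m z) atTop (𝓝 c))
    (a : ℂ) : Tendsto (fun m => iterAverage (fiber R) d φ m a) atTop (𝓝 c) := by
  have key : ∀ (n : ℕ) (a : ℂ), ‖a‖ ≤ 2 ^ n * r →
      Tendsto (fun m => iterAverage (fiber R) d φ m a) atTop (𝓝 c) := by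
    intro n
    induction n with
    | zero => simpa using hball
    | succ n ih =>
      intro a ha
      refine tendsto_iterAverage_of_fiber hd ?_ fun x hx => ?_
      · rw [hfib, Multiset.card_map, ← (IsAlgClosed.splits _).natDegree_eq_card_roots, hdeg]
      · rw [hfib] at hx
        obtain ⟨w, hw, rfl⟩ := Multiset.mem_map.1 hx
        refine ih w ?_
        have h1 := hR a w (by rw [← eval_slice]; exact Polynomial.isRoot_of_mem_roots hw)
        have h2 : (1 : ℝ) ≤ 2 ^ n := one_le_pow₀ one_le_two
        have h3 : max r ‖a‖ ≤ 2 ^ (n + 1) * r :=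
          max_le (le_mul_of_one_le_left hr.le (one_le_pow₀ one_le_two)) ha
        rw [pow_succ] at h3
        linarith
  obtain ⟨n, hn⟩ := pow_unbounded_of_one_lt (‖a‖ / r) one_lt_two
  exact key n a ((div_le_iff₀ hr).1 hn.le)

/-- Finiteness is carried through the induction because `hfib` describes the fibers over finite
points only. -/
theorem mem_of_mem_iter_of_forwardInvariant
    (hfib : ∀ z : ℂ, fiber R z = (slice R z).roots.map fun w : ℂ => (w : Sphere))
    {S : Set Sphere} (hS : ForwardInvariant R S) {a : ℂ} (ha : (a : Sphere) ∈ S) (m : ℕ) :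
    ∀ x ∈ iter (fiber R) m a, x ∈ S ∧ ∃ z : ℂ, x = z := by
  induction m with
  | zero =>
    intro x hx
    obtain rfl := Multiset.mem_singleton.1 hx
    exact ⟨ha, a, rfl⟩
  | succ m ih =>
    intro x hx
    obtain ⟨y, hy, hxy⟩ := Multiset.mem_bind.1 hx
    obtain ⟨hyS, z, rfl⟩ := ih y hy
    rw [hfib] at hxy
    obtain ⟨w, hw, rfl⟩ := Multiset.mem_map.1 hxy
    refine ⟨hS (Set.mem_biUnion hyS (subset_closure ⟨z, w, ?_, rfl⟩)), w, rfl⟩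
    rw [← eval_slice]
    exact Polynomial.isRoot_of_mem_roots hw

end Equilibrium

end HolCorr

/-! ### The equilibrium measure -/

open HolCorr

theorem theoremA (d : ℕ) (hd : 0 < d) (R₀ : Polynomial ℂ) (hR₀ : R₀.natDegree = d)
    (hsimple : ∀ ζ : ℂ, R₀.IsRoot ζ → R₀.rootMultiplicity ζ = 1)
    (P : MvPolynomial (Fin 2) ℂ) (hP : P.totalDegree ≤ d) (ε : ℝ) (hε : 0 < ε) :
    ∃ Δ : ℝ, 0 < Δ ∧ ∀ δ : ℂ, ‖δ‖ < Δ →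
      ∃ μ : MeasureTheory.Measure HolCorr.Sphere,
        MeasureTheory.IsProbabilityMeasure μ ∧ μ.Regular ∧
        HolCorr.pushforward (HolCorr.fiber (HolCorr.perturbed R₀ P δ)) μ = (d : ENNReal) • μ ∧
        (∀ a : ℂ, HolCorr.WeakStarTendsto
          (fun m => ((d : ENNReal) ^ m)⁻¹ •
            HolCorr.pushforward (HolCorr.iter (HolCorr.fiber (HolCorr.perturbed R₀ P δ)) m)
              (MeasureTheory.Measure.dirac (a : HolCorr.Sphere))) μ) ∧
        μ.support ⊆ (fun z : ℂ => (z : HolCorr.Sphere)) ''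
          Metric.thickening ε {ζ : ℂ | R₀.IsRoot ζ} ∧
        IsLeast {S : Set HolCorr.Sphere | IsClosed S ∧
            HolCorr.ForwardInvariant (HolCorr.perturbed R₀ P δ) S ∧
            ∃ a : ℂ, (a : HolCorr.Sphere) ∈ S} μ.support := by
  have h0 : R₀ ≠ 0 := by rintro rfl; simp at hR₀; omega
  obtain ⟨r, hr, Δ, hΔ, H⟩ := exists_contracting_branches hR₀ h0 hsimple hP hε
  refine ⟨Δ, hΔ, fun δ hδ => ?_⟩
  obtain ⟨hR, hslice, g, hgK, hgε, hgroots⟩ := H δ hδ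
  set R := perturbed R₀ P δ with hRdef
  let X := Metric.closedBall (0 : ℂ) r
  have hX : CompactSpace X := isCompact_iff_compactSpace.1 (isCompact_closedBall _ _)
  have hXne : Nonempty X := ⟨⟨0, Metric.mem_closedBall_self hr.le⟩⟩
  have hfib : ∀ z : ℂ, fiber R z = (slice R z).roots.map fun w : ℂ => (w : Sphere) := fun z =>
    fiber_coe ((degreeOf_perturbed_le hR₀.le hP δ).trans (hslice z).2.ge)
  let j : X → Sphere := fun z => ((z : ℂ) : Sphere)
  have hjc : Continuous j := OnePoint.continuous_coe.comp continuous_subtype_val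
  have hj : IsClosedEmbedding j :=
    hjc.isClosedEmbedding (OnePoint.coe_injective.comp Subtype.val_injective)
  have hF : ∀ x : X, fiber R (j x) = Finset.univ.val.map fun ζ => j (g ζ x) := fun x => by
    rw [hfib, hgroots, Multiset.map_map]
    rfl
  have hcard : Fintype.card R₀.roots.toFinset = d := by
    have h := congrArg Multiset.card (hgroots (Classical.arbitrary X))
    rw [← (IsAlgClosed.splits _).natDegree_eq_card_roots, (hslice _).2] at h
    rw [h, Multiset.card_map]
    rfl
  have hι : Nonempty R₀.roots.toFinset := Fintype.card_pos_iff.1 (hcard ▸ hd)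
  have hgc : ∀ ζ, Continuous (g ζ) := fun ζ => (hgK ζ).continuous
  obtain ⟨ν, hν, hinv, hlim⟩ := exists_invariant_measure (by
    rw [← NNReal.coe_lt_coe]; norm_num) hgK
  rw [hcard] at hinv
  set μ := ν.map j with hμ
  have hprob : IsProbabilityMeasure μ := Measure.isProbabilityMeasure_map hjc.aemeasurable
  have hreg : μ.Regular := by
    have : μ.InnerRegular := Measure.InnerRegular.map_of_continuous hjc
    infer_instance
  have hweak : ∀ (a : ℂ) (φ : C(Sphere, ℂ)),
      Tendsto (fun m => iterAverage (fiber R) d φ m a) atTop (𝓝 (∫ x, φ x ∂μ)) := by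
    intro a φ
    refine tendsto_iterAverage_of_closedBall hd.ne' hr hR hfib (fun z => (hslice z).2)
      (fun z hz => ?_) a
    rw [hμ, integral_map hjc.aemeasurable φ.continuous.aestronglyMeasurable]
    have h := hlim (φ ∘ j) (φ.continuous.comp hjc) ⟨z, mem_closedBall_zero_iff.2 hz⟩
    simp_rw [← iterAverage_eq_transfer hF, hcard] at h
    exact h
  have hcompact : IsCompact (⋃ ζ, Set.range (g ζ)) :=
    isCompact_iUnion fun ζ => isCompact_range (hgc ζ)
  have hsupp : μ.support ⊆ j '' ⋃ ζ, Set.range (g ζ) := by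
    refine Measure.support_subset_of_isClosed (hcompact.image hjc).isClosed ?_
    rw [hμ, mem_ae_map_iff hjc.aemeasurable (hcompact.image hjc).isClosed.measurableSet,
      Set.preimage_image_eq _ hj.injective]
    exact ae_mem_iUnion_range (fun ζ => (hgc ζ).measurable) (Nat.cast_ne_zero.2 hd.ne') hinv
      hcompact.isClosed.measurableSet
  refine ⟨μ, hprob, hreg, ?_, ?_, ?_, ⟨Measure.isClosed_support, ?_, ?_⟩, ?_⟩
  · exact pushforward_map_eq_smul hj.measurableEmbedding (fun ζ => (hgc ζ).measurable) hF hinv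
  · intro a φ
    simp_rw [integral_pushforward_iter]
    exact hweak a φ
  · refine hsupp.trans ?_
    rintro _ ⟨x, hx, rfl⟩
    obtain ⟨ζ, y, rfl⟩ := Set.mem_iUnion.1 hx
    refine ⟨_, Metric.mem_thickening_iff.2 ⟨ζ, ?_, hgε ζ y⟩, rfl⟩
    exact Polynomial.isRoot_of_mem_roots (Multiset.mem_toFinset.1 ζ.2)
  · refine Set.iUnion₂_subset fun z hz w hw => ?_
    obtain ⟨x, -, rfl⟩ := hsupp hz
    obtain ⟨w, hw, rfl⟩ := (mem_image_coe_iff hR _ _).1 hw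
    have hmem : w ∈ (slice R (x : ℂ)).roots :=
      (Polynomial.mem_roots (hslice x).1).2 (by rwa [Polynomial.IsRoot, eval_slice])
    rw [hgroots] at hmem
    obtain ⟨ζ, -, rfl⟩ := Multiset.mem_map.1 hmem
    exact mem_support_of_invariant hj.isEmbedding hgc hinv hz ζ
  · have hne : μ.support.Nonempty := by
      by_contra! h
      -- Regularity makes the complement of the support null, so an empty support contradicts total
      -- mass 1.
      have := Measure.measure_compl_support_of_regular (μ := μ)
      simp [h] at this
    obtain ⟨z, hz⟩ := hne
    obtain ⟨x, -, rfl⟩ := hsupp hz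
    exact ⟨x, hz⟩
  · rintro S ⟨hS, hSinv, a, ha⟩
    refine support_subset_of_integral_eq_zero hS fun φ hφ => ?_
    -- All iterates of a lie in S, where φ vanishes, so the averages converging to the integral are
    -- all 0.
    refine tendsto_nhds_unique (hweak a φ) (tendsto_const_nhds.congr fun m => ?_)
    rw [iterAverage, Multiset.sum_eq_zero, mul_zero]
    intro y hy
    obtain ⟨x, hx, rfl⟩ := Multiset.mem_map.1 hy
    exact hφ x (mem_of_mem_iter_of_forwardInvariant hfib hSinv ha m x hx).1
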